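/- Let $X$ be a set. A \emph{scale} on $X$ is a cover of $X$ by subsets. For $A\subseteq X$ and a scale $\mathcal V$, let $st(A,\mathcal V)$ be the union of all $V\in\mathcal V$ with $V\cap A\neq\emptyset$. A scale $\mathcal U$ \emph{refines} $\mathcal V$ (and $\mathcal V$ \emph{coarsens} $\mathcal U$) if every member of $\mathcal U$ is contained in a member of $\mathcal V$; $\mathcal U$ \emph{star refines} $\mathcal V$ if $st(\mathcal U,\mathcal U)=\{st(U,\mathcal U): U\in\mathcal U\}$ refines $\mathcal V$. A \emph{small scale structure} (ss-structure) on $X$ is a nonempty collection $\mathcal{SS}$ of scales on $X$ such that (1) every scale that coarsens a member of $\mathcal{SS}$ belongs to $\mathcal{SS}$, and (2) for all $\mathcal U_1,\mathcal U_2\in\mathcal{SS}$ there is $\mathcal U_3\in\mathcal{SS}$ that star refines both $\mathcal U_1$ and $\mathcal U_2$. A \emph{base} for $\mathcal{SS}$ is a subcollection $\mathcal B\subseteq\mathcal{SS}$ such that every member of $\mathcal{SS}$ is refined by some member of $\mathcal B$. The topology induced by $\mathcal{SS}$ consists of the sets $O\subseteq X$ such that for each $x\in O$ there is $\mathcal V\in\mathcal{SS}$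 with $st(\{x\},\mathcal V)\subseteq O$. \textbf{Corollary.} A Hausdorff topological space $X$ is paracompact if and only if the collection of all open covers of $X$ is a base for an ss-structure on $X$ and that ss-structure induces the original topology of $X$. -/

import Mathlib

namespace SmallScale

variable {X : Type*}

/-- A scale on `X` is a cover of `X`, i.e. a family of subsets whose union is `X`. -/
def IsScale (U : Set (Set X)) : Prop := ⋃₀ U = Set.univ

/-- The star `st(A, V)`: the union of all members of `V` that intersect `A`. -/
def star (A : Set X) (V : Set (Set X)) : Set X := ⋃₀ {B ∈ V | (B ∩ A).Nonempty}

/-- The family `st(U, V)` of all stars `st(A, V)` with `A ∈ U`. -/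
def starFamily (U V : Set (Set X)) : Set (Set X) := {S | ∃ A ∈ U, S = star A V}

/-- `U` refines `V` (equivalently, `V` coarsens `U`): every member of `U` is contained in some
member of `V`. -/
def Refines (U V : Set (Set X)) : Prop := ∀ A ∈ U, ∃ B ∈ V, A ⊆ B

/-- `U` star refines `V`: the family `st(U, U)` refines `V`. -/
def StarRefines (U V : Set (Set X)) : Prop := Refines (starFamily U U) V

end SmallScale

/-- A small scale structure on `X`: a filter of scales on `X` with respect to star refinement. -/
structure SmallScaleStructure (X : Type*) where
  /-- The collection of scales belonging to the structure. -/
  scales : Set (Set (Set X))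
  isScale : ∀ U ∈ scales, SmallScale.IsScale U
  nonempty : scales.Nonempty
  coarsen : ∀ U ∈ scales, ∀ V : Set (Set X),
    SmallScale.IsScale V → SmallScale.Refines U V → V ∈ scales
  star_refine : ∀ U ∈ scales, ∀ V ∈ scales,
    ∃ W ∈ scales, SmallScale.StarRefines W U ∧ SmallScale.StarRefines W V

namespace SmallScaleStructure

variable {X : Type*}

/-- `B` is a base for `S`: it consists of scales of `S`, and every scale of `S` is refined by
some member of `B`. -/
def IsBase (S : SmallScaleStructure X) (B : Set (Set (Set X))) : Prop :=
  B ⊆ S.scales ∧ ∀ U ∈ S.scales, ∃ V ∈ B, SmallScale.Refines V U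

/-- The topology induced by a small scale structure: `O` is open if for each `x ∈ O` there is a
scale `V` of the structure with `st({x}, V) ⊆ O`. -/
abbrev inducedTopology (S : SmallScaleStructure X) : TopologicalSpace X where
  IsOpen O := ∀ x ∈ O, ∃ V ∈ S.scales, SmallScale.star {x} V ⊆ O
  isOpen_univ := fun _ _ => by
    obtain ⟨V, hV⟩ := S.nonempty
    exact ⟨V, hV, Set.subset_univ _⟩
  isOpen_inter := by
    rintro O P hO hP x ⟨hxO, hxP⟩
    obtain ⟨U, hU, hUO⟩ := hO x hxO
    obtain ⟨V, hV, hVP⟩ := hP x hxP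
    obtain ⟨W, hW, hWU, hWV⟩ := S.star_refine U hU V hV
    have key : ∀ U' : Set (Set X), SmallScale.StarRefines W U' →
        SmallScale.star {x} W ⊆ SmallScale.star {x} U' := by
      rintro U' h y ⟨A, ⟨hA, z, hzA, hz⟩, hyA⟩
      obtain ⟨B, hB, hAB⟩ := h _ ⟨A, hA, rfl⟩
      have hsub : A ⊆ B := fun a ha => hAB ⟨A, ⟨hA, a, ha, ha⟩, ha⟩
      exact ⟨B, ⟨hB, z, hsub hzA, hz⟩, hsub hyA⟩
    exact ⟨W, hW, fun y hy => ⟨hUO (key U hWU hy), hVP (key V hWV hy)⟩⟩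
  isOpen_sUnion := by
    rintro s hs x ⟨O, hO, hxO⟩
    obtain ⟨V, hV, hVO⟩ := hs O hO x hxO
    exact ⟨V, hV, fun y hy => ⟨O, hO, hVO hy⟩⟩

end SmallScaleStructure

/-- The collection of all open covers of a topological space. -/
def SmallScale.openCovers (X : Type*) [TopologicalSpace X] : Set (Set (Set X)) :=
  {U | SmallScale.IsScale U ∧ ∀ A ∈ U, IsOpen A}

open Set Filter Topology Uniformity SmallScale

namespace SmallScale

variable {X : Type*}

/-! The core is Stone's theorem: a Hausdorff space is paracompact iff every open cover has an open
star refinement. Forward, a locally finite refinement shrunk to closed sets gives a point-star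
refinement (`exists_pointStarRefines`), and two of these give a star refinement. Backward, iterated
star refinements of a cover generate a countably based uniformity. Its topology is pseudometrizable,
hence paracompact, and coarser than the given one; the interiors of the cover's members in it still
cover. -/

theorem IsScale.exists_mem {U : Set (Set X)} (hU : IsScale U) (x : X) : ∃ A ∈ U, x ∈ A :=
  mem_sUnion.1 (hU.symm ▸ mem_univ x)

theorem isScale_of_forall {U : Set (Set X)} (h : ∀ x, ∃ A ∈ U, x ∈ A) : IsScale U :=
  eq_univ_of_forall fun x => mem_sUnion.2 (h x)

theorem mem_star_singleton {x y : X} {V : Set (Set X)} :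
    y ∈ star {x} V ↔ ∃ A ∈ V, x ∈ A ∧ y ∈ A := by
  simp [star, and_assoc]

theorem Refines.trans {U V W : Set (Set X)} (h₁ : Refines U V) (h₂ : Refines V W) :
    Refines U W := fun A hA =>
  let ⟨B, hB, hAB⟩ := h₁ A hA
  let ⟨C, hC, hBC⟩ := h₂ B hB
  ⟨C, hC, hAB.trans hBC⟩

theorem Refines.refl (U : Set (Set X)) : Refines U U := fun A hA => ⟨A, hA, Subset.rfl⟩

theorem starFamily_mono {U V : Set (Set X)} (h : Refines U V) :
    Refines (starFamily U U) (starFamily V V) := by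
  rintro _ ⟨A, hA, rfl⟩
  obtain ⟨B, hB, hAB⟩ := h A hA
  refine ⟨_, ⟨B, hB, rfl⟩, ?_⟩
  rintro y ⟨C, ⟨hC, z, hzC, hzA⟩, hyC⟩
  obtain ⟨D, hD, hCD⟩ := h C hC
  exact ⟨D, ⟨hD, z, hCD hzC, hAB hzA⟩, hCD hyC⟩

theorem StarRefines.mono {U U' V V' : Set (Set X)} (h : StarRefines U V) (hU : Refines U' U)
    (hV : Refines V V') : StarRefines U' V' :=
  ((starFamily_mono hU).trans h).trans hV

/-- `U` point-star refines `V`: the star of each point in `U` lies in a member of `V`. -/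
def PointStarRefines (U V : Set (Set X)) : Prop := ∀ x, ∃ B ∈ V, star {x} U ⊆ B

/-- Point-star refining twice yields a star refinement. -/
theorem PointStarRefines.starRefines {U V W : Set (Set X)} (h₁ : PointStarRefines W V)
    (h₂ : PointStarRefines V U) (hW : ∀ A ∈ W, A.Nonempty) : StarRefines W U := by
  rintro _ ⟨A, hA, rfl⟩
  obtain ⟨x, hx⟩ := hW A hA
  obtain ⟨B, hB, hxB⟩ := h₂ x
  refine ⟨B, hB, ?_⟩
  rintro y ⟨C, ⟨hC, z, hzC, hzA⟩, hyC⟩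
  -- `A` and `C` share `z`, so `D` contains both. Thus every such `D` contains the fixed point `x`.
  obtain ⟨D, hD, hzD⟩ := h₁ z
  exact hxB <| mem_star_singleton.2 ⟨D, hD, hzD <| mem_star_singleton.2 ⟨A, hA, hzA, hx⟩,
    hzD <| mem_star_singleton.2 ⟨C, hC, hzC, hyC⟩⟩

/-- If `y ∈ F i`, any `W x` containing `y` has `x ∈ F i`, since `W x` avoids every `F j` missing
`x`; hence `W x ⊆ v i`. Local finiteness makes `W x` open. -/
theorem exists_pointStarRefines [TopologicalSpace X] [T2Space X] [ParacompactSpace X]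
    {U : Set (Set X)} (hU : U ∈ openCovers X) :
    ∃ W ∈ openCovers X, PointStarRefines W U ∧ ∀ A ∈ W, A.Nonempty := by
  obtain ⟨v, vo, vc, vf, vu⟩ := precise_refinement (fun A : U => (A : Set X))
    (fun A => hU.2 A A.2) (by rw [← sUnion_eq_iUnion]; exact hU.1)
  obtain ⟨F, Fc, Fcl, Fv⟩ := exists_iUnion_eq_closed_subset vo vf.point_finite vc
  have Ff : LocallyFinite F := vf.subset Fv
  let W : X → Set X := fun x => (⋂ i ∈ {i | x ∈ F i}, v i) ∩ ⋂ i, ⋂ (_ : x ∉ F i), (F i)ᶜ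
  have memW : ∀ x, x ∈ W x := fun x =>
    ⟨mem_iInter₂.2 fun i hi => Fv i hi, mem_iInter₂.2 fun i hi => hi⟩
  have openW : ∀ x, IsOpen (W x) := by
    refine fun x => ((Ff.point_finite x).isOpen_biInter fun i _ => vo i).inter ?_
    have h : IsClosed (⋃ i : {i // x ∉ F i}, F i) :=
      (Ff.comp_injective Subtype.val_injective).isClosed_iUnion fun i => Fcl _
    convert h.isOpen_compl using 1
    ext y
    simp
  refine ⟨range W, ⟨isScale_of_forall fun x => ⟨_, ⟨x, rfl⟩, memW x⟩, ?_⟩, fun y => ?_, ?_⟩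
  · rintro _ ⟨x, rfl⟩
    exact openW x
  · obtain ⟨i, hi⟩ := mem_iUnion.1 (Fc.symm ▸ mem_univ y)
    refine ⟨i, i.2, fun z hz => ?_⟩
    obtain ⟨_, ⟨x, rfl⟩, hy, hz⟩ := mem_star_singleton.1 hz
    have hxi : x ∈ F i := by
      by_contra h
      exact mem_iInter₂.1 hy.2 i h hi
    exact vu i (mem_iInter₂.1 hz.1 i hxi)
  · rintro _ ⟨x, rfl⟩
    exact ⟨x, memW x⟩

/-- Every open cover of a paracompact Hausdorff space has an open star refinement. -/
theorem exists_starRefines [TopologicalSpace X] [T2Space X] [ParacompactSpace X]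
    {U : Set (Set X)} (hU : U ∈ openCovers X) : ∃ W ∈ openCovers X, StarRefines W U := by
  obtain ⟨V, hV, hVU, -⟩ := exists_pointStarRefines hU
  obtain ⟨W, hW, hWV, hne⟩ := exists_pointStarRefines hV
  exact ⟨W, hW, hWV.starRefines hVU hne⟩

theorem exists_common_refinement [TopologicalSpace X] {U V : Set (Set X)}
    (hU : U ∈ openCovers X) (hV : V ∈ openCovers X) :
    ∃ W ∈ openCovers X, Refines W U ∧ Refines W V := by
  refine ⟨image2 (· ∩ ·) U V, ⟨isScale_of_forall fun x => ?_, ?_⟩, ?_, ?_⟩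
  · obtain ⟨A, hA, hxA⟩ := hU.1.exists_mem x
    obtain ⟨B, hB, hxB⟩ := hV.1.exists_mem x
    exact ⟨_, mem_image2_of_mem hA hB, hxA, hxB⟩
  · rintro _ ⟨A, hA, B, hB, rfl⟩
    exact (hU.2 A hA).inter (hV.2 B hB)
  · rintro _ ⟨A, hA, B, hB, rfl⟩
    exact ⟨A, hA, inter_subset_left⟩
  · rintro _ ⟨A, hA, B, hB, rfl⟩
    exact ⟨B, hB, inter_subset_right⟩

/-- The scales of a paracompact Hausdorff space that are refined by an open cover. -/
def openCoverStructure (X : Type*) [TopologicalSpace X] [T2Space X] [ParacompactSpace X] :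
    SmallScaleStructure X where
  scales := {U | IsScale U ∧ ∃ V ∈ openCovers X, Refines V U}
  isScale _ hU := hU.1
  nonempty := by
    have h : IsScale ({univ} : Set (Set X)) := isScale_of_forall fun x => ⟨univ, rfl, trivial⟩
    exact ⟨{univ}, h, {univ}, ⟨h, by simp⟩, Refines.refl _⟩
  coarsen := fun _ ⟨_, W, hW, hWU⟩ _ hV hUV => ⟨hV, W, hW, hWU.trans hUV⟩
  star_refine := by
    rintro U ⟨-, U', hU', hUU'⟩ V ⟨-, V', hV', hVV'⟩
    obtain ⟨W', hW', hWU, hWV⟩ := exists_common_refinement hU' hV'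
    obtain ⟨W, hW, hWW'⟩ := exists_starRefines hW'
    exact ⟨W, ⟨hW.1, W, hW, Refines.refl _⟩, hWW'.mono (Refines.refl _) (hWU.trans hUU'),
      hWW'.mono (Refines.refl _) (hWV.trans hVV')⟩

theorem openCoverStructure_isBase (X : Type*) [TopologicalSpace X] [T2Space X]
    [ParacompactSpace X] : (openCoverStructure X).IsBase (openCovers X) :=
  ⟨fun U hU => ⟨hU.1, U, hU, Refines.refl _⟩, fun _ hU => hU.2⟩

theorem openCoverStructure_inducedTopology (X : Type*) [t : TopologicalSpace X] [T2Space X]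
    [ParacompactSpace X] : (openCoverStructure X).inducedTopology = t := by
  refine TopologicalSpace.ext (funext fun O => propext ⟨fun h => ?_, fun hO x hx => ?_⟩)
  · refine isOpen_iff_mem_nhds.2 fun x hx => ?_
    obtain ⟨V, ⟨-, W, hW, hWV⟩, hVO⟩ := h x hx
    obtain ⟨A, hA, hxA⟩ := hW.1.exists_mem x
    obtain ⟨B, hB, hAB⟩ := hWV A hA
    exact mem_of_superset ((hW.2 A hA).mem_nhds hxA) fun y hy =>
      hVO (mem_star_singleton.2 ⟨B, hB, hAB hxA, hAB hy⟩)
  -- Only `O` contains `x` in this cover, so the star of `x` is `O`; points being closed makes it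
  -- open.
  · have hV : ({O, {x}ᶜ} : Set (Set X)) ∈ openCovers X := by
      refine ⟨isScale_of_forall fun y => ?_, ?_⟩
      · by_cases hy : y = x
        · exact ⟨O, by simp, hy ▸ hx⟩
        · exact ⟨{x}ᶜ, by simp, hy⟩
      · rintro A (rfl | rfl)
        · exact hO
        · exact isOpen_compl_singleton
    refine ⟨_, (openCoverStructure_isBase X).1 hV, fun y hy => ?_⟩
    obtain ⟨A, rfl | rfl, hxA, hyA⟩ := mem_star_singleton.1 hy
    · exact hyA
    · exact absurd rfl hxA

/-- The pairs of points lying in a common member of `V`. -/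
def entourage (V : Set (Set X)) : Set (X × X) := {p | ∃ A ∈ V, p.1 ∈ A ∧ p.2 ∈ A}

/-- The uniformity generated by a sequence of scales, each star refining the previous one. -/
def uniformCore (V : ℕ → Set (Set X)) (hV : ∀ n, IsScale (V n))
    (hs : ∀ n, StarRefines (V (n + 1)) (V n)) : UniformSpace.Core X :=
  have comp : ∀ n x y z, (x, y) ∈ entourage (V (n + 1)) → (y, z) ∈ entourage (V (n + 1)) →
      (x, z) ∈ entourage (V n) := by
    rintro n x y z ⟨A, hA, hxA, hyA⟩ ⟨B, hB, hyB, hzB⟩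
    obtain ⟨C, hC, hAC⟩ := hs n _ ⟨A, hA, rfl⟩
    exact ⟨C, hC, hAC ⟨A, ⟨hA, x, hxA, hxA⟩, hxA⟩, hAC ⟨B, ⟨hB, y, hyB, hyA⟩, hzB⟩⟩
  have refl : ∀ n x, (x, x) ∈ entourage (V n) := fun n x =>
    let ⟨A, hA, hxA⟩ := (hV n).exists_mem x
    ⟨A, hA, hxA, hxA⟩
  have anti : Antitone fun n => entourage (V n) :=
    antitone_nat_of_succ_le fun n ⟨x, y⟩ h => comp n x x y (refl _ x) h
  UniformSpace.Core.mkOfBasis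
    { sets := range fun n => entourage (V n)
      nonempty := range_nonempty _
      inter_sets := by
        rintro _ _ ⟨m, rfl⟩ ⟨n, rfl⟩
        exact ⟨_, ⟨max m n, rfl⟩,
          subset_inter (anti (le_max_left m n)) (anti (le_max_right m n))⟩ }
    (by rintro _ ⟨n, rfl⟩; exact refl n)
    (by
      rintro _ ⟨n, rfl⟩
      exact ⟨_, ⟨n, rfl⟩, fun _ ⟨A, hA, h₁, h₂⟩ => ⟨A, hA, h₂, h₁⟩⟩)
    (by
      rintro _ ⟨n, rfl⟩
      refine ⟨_, ⟨n + 1, rfl⟩, ?_⟩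
      rintro ⟨x, z⟩ ⟨y, h₁, h₂⟩
      exact comp n x y z h₁ h₂)

theorem hasBasis_uniformCore (V : ℕ → Set (Set X)) (hV : ∀ n, IsScale (V n))
    (hs : ∀ n, StarRefines (V (n + 1)) (V n)) :
    (uniformCore V hV hs).uniformity.HasBasis (fun _ : ℕ => True) fun n => entourage (V n) :=
  ⟨fun s => by
    refine (FilterBasis.mem_filter_iff _).trans ?_
    constructor
    · rintro ⟨_, ⟨n, rfl⟩, h⟩
      exact ⟨n, trivial, h⟩
    · rintro ⟨n, -, h⟩
      exact ⟨_, ⟨n, rfl⟩, h⟩⟩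

/-- A space in which every open cover has an open star refinement is paracompact: a sequence of
successive star refinements generates a coarser pseudometrizable topology. -/
theorem paracompactSpace_of_starRefines [t : TopologicalSpace X]
    (h : ∀ U ∈ openCovers X, ∃ W ∈ openCovers X, StarRefines W U) : ParacompactSpace X where
  locallyFinite_refinement α s so sc := by
    have hU : range s ∈ openCovers X :=
      ⟨by rw [IsScale, sUnion_range, sc], forall_mem_range.2 so⟩
    choose! next hnext hstar using h
    let V : ℕ → Set (Set X) := fun n => next^[n] (range s)
    have V_succ : ∀ n, V (n + 1) = next (V n) := fun n => Function.iterate_succ_apply' _ _ _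
    have hV : ∀ n, V n ∈ openCovers X := fun n => by
      induction n with
      | zero => exact hU
      | succ n ih => rw [V_succ]; exact hnext _ ih
    have hs : ∀ n, StarRefines (V (n + 1)) (V n) := fun n => by
      rw [V_succ]
      exact hstar _ (hV n)
    let u : UniformSpace X := UniformSpace.ofCore (uniformCore V (fun n => (hV n).1) hs)
    have hb : (𝓤[u]).HasBasis (fun _ : ℕ => True) fun n => entourage (V n) :=
      hasBasis_uniformCore V _ hs
    have : IsCountablyGenerated (𝓤[u]) := hb.isCountablyGenerated
    have hp : @ParacompactSpace X u.toTopologicalSpace := by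
      let := UniformSpace.pseudoMetricSpace X
      infer_instance
    have hle : t ≤ u.toTopologicalSpace := by
      refine TopologicalSpace.le_def.2 fun O hO => isOpen_iff_mem_nhds.2 fun x hx => ?_
      obtain ⟨n, -, hn⟩ := (@nhds_basis_uniformity' X _ u _ _ hb x).mem_iff.1
        (@IsOpen.mem_nhds X u.toTopologicalSpace x O hO hx)
      obtain ⟨A, hA, hxA⟩ := (hV n).1.exists_mem x
      exact mem_of_superset (((hV n).2 A hA).mem_nhds hxA) fun y hy => hn ⟨A, hA, hxA, hy⟩
    have hcov : ⋃ a, @interior X u.toTopologicalSpace (s a) = univ := by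
      refine eq_univ_of_forall fun x => ?_
      obtain ⟨A, hA, hxA⟩ := (hV 1).1.exists_mem x
      -- `V 0` is `range s`, and the `V 1`-ball about `x` lies in the star of `A`, hence in `s a`.
      obtain ⟨_, ⟨a, rfl⟩, hAa⟩ := hs 0 _ ⟨A, hA, rfl⟩
      refine mem_iUnion.2 ⟨a, (@mem_interior_iff_mem_nhds X u.toTopologicalSpace _ _).2 ?_⟩
      refine (@nhds_basis_uniformity' X _ u _ _ hb x).mem_iff.2 ⟨1, trivial, ?_⟩
      rintro y ⟨B, hB, hxB, hyB⟩
      exact hAa ⟨B, ⟨hB, x, hxB, hxA⟩, hyB⟩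
    obtain ⟨v, vo, vc, vf, vs⟩ := @precise_refinement α X u.toTopologicalSpace hp _
      (fun a => @isOpen_interior X u.toTopologicalSpace (s a)) hcov
    refine ⟨α, v, fun a => hle _ (vo a), vc, fun x => ?_, fun a =>
      ⟨a, (vs a).trans (@interior_subset X u.toTopologicalSpace (s a))⟩⟩
    obtain ⟨N, hN, hfin⟩ := vf x
    exact ⟨N, nhds_mono hle hN, hfin⟩

end SmallScale

theorem mainTheorem10 {X : Type*} [t : TopologicalSpace X] [T2Space X] :
    ParacompactSpace X ↔
      ∃ S : SmallScaleStructure X,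
        S.IsBase (SmallScale.openCovers X) ∧ S.inducedTopology = t := by
  refine ⟨fun _ => ⟨openCoverStructure X, openCoverStructure_isBase X,
    openCoverStructure_inducedTopology X⟩, ?_⟩
  rintro ⟨S, hS, -⟩
  refine paracompactSpace_of_starRefines fun U hU => ?_
  obtain ⟨V, hV, hVU, -⟩ := S.star_refine U (hS.1 hU) U (hS.1 hU)
  -- `V` need not be open; the base supplies an open `W` refining it, which still star refines `U`.
  obtain ⟨W, hW, hWV⟩ := hS.2 V hV
  exact ⟨W, hW, hVU.mono hWV (Refines.refl _)⟩
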